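/- Let $m$ be an odd positive integer, let $n=2m$, let $k$ be a positive integer with $\gcd(n,k)=1$, and let $\theta\in\mathbb{F}_{2^m}^*=\mathbb{F}_{2^m}\setminus\{0\}$. For $x\in\mathbb{F}_{2^n}$ write $\overline{x}=x^{2^m}$, and let $F:\mathbb{F}_{2^n}\to\mathbb{F}_{2^n}$ be $$F(x)=c_1x^{2^k+1}+c_2\overline{x}^{2^k+1}+c_3x^{2^k}\overline{x}+c_4x\overline{x}^{2^k},$$ where $$\begin{aligned} c_1&=1+\theta+\theta^2+(\theta+\theta^2)^{2^k+1}+\theta^{2(2^k+1)},\\ c_2&=(1+\theta+\theta^2)^{2^k}+(\theta+\theta^2)^{2^k+1}+\theta^{2(2^k+1)},\\ c_3&=1+(\theta+\theta^2)^{2^k+1},\\ c_4&=(1+\theta+\theta^2)^{2^k+1}+(\theta+\theta^2)^{2^k+1}+\theta^{2(2^k+1)}. \end{aligned}$$ Then $F$ is a permutation of $\mathbb{F}_{2^n}$ whose boomerang uniformity $$\beta(F)=\max_{a,b\in\mathbb{F}_{2^n}\setminus\{0\}}\#\{x\in\mathbb{F}_{2^n}: F^{-1}(F(x)+b)+F^{-1}(F(x+a)+b)=a\}$$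 equals $4$, and $F$ is differentially $4$-uniform, that is, $$\delta(F)=\max_{a\in\mathbb{F}_{2^n}\setminus\{0\},\,b\in\mathbb{F}_{2^n}}\#\{x\in\mathbb{F}_{2^n}: F(x)+F(x+a)=b\}=4.$$ Moreover, put $\alpha=\frac{1}{1+\theta+\theta^2}$, $\beta=\frac{\theta^2}{1+\theta+\theta^2}$ and $R(x,y)=(x+\alpha y)^{2^k+1}+(\beta y)^{2^k+1}$ for $x,y\in\mathbb{F}_{2^m}$. Then $F$ is affine equivalent to the closed butterfly $V_R:\mathbb{F}_{2^m}^2\to\mathbb{F}_{2^m}^2$, $V_R(x,y)=(R(x,y),R(y,x))$, that is, $F=B\circ V_R\circ A$ for some bijective $\mathbb{F}_2$-affine maps $A:\mathbb{F}_{2^n}\to\mathbb{F}_{2^m}^2$ and $B:\mathbb{F}_{2^m}^2\to\mathbb{F}_{2^n}$. -/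

import Mathlib

/-- Entry of the difference distribution table: the number of `x` with `F x + F (x + a) = b`. -/
noncomputable def ddt {V : Type*} [AddCommGroup V] (F : V → V) (a b : V) : ℕ :=
  Nat.card {x : V // F x + F (x + a) = b}

/-- Differential uniformity: the largest entry `ddt F a b` over `a ≠ 0` and all `b`
(a true maximum whenever `V` is finite and nontrivial). -/
noncomputable def differentialUniformity {V : Type*} [AddCommGroup V] (F : V → V) : ℕ :=
  sSup {d : ℕ | ∃ a b : V, a ≠ 0 ∧ d = ddt F a b}

/-- Entry of the boomerang connectivity table of a permutation `F`: the number of `x` with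
`F⁻¹ (F x + b) + F⁻¹ (F (x + a) + b) = a`. -/
noncomputable def bct {V : Type*} [AddCommGroup V] (F : Equiv.Perm V) (a b : V) : ℕ :=
  Nat.card {x : V // F.symm (F x + b) + F.symm (F (x + a) + b) = a}

/-- Boomerang uniformity: the largest entry `bct F a b` over `a ≠ 0` and `b ≠ 0`
(a true maximum whenever `V` is finite and nontrivial). -/
noncomputable def boomerangUniformity {V : Type*} [AddCommGroup V] (F : Equiv.Perm V) : ℕ :=
  sSup {d : ℕ | ∃ a b : V, a ≠ 0 ∧ b ≠ 0 ∧ d = bct F a b}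

/-- Affine equivalence of self-maps of two vector spaces over the field with two elements:
`F = B ∘ G ∘ A` for affine bijections `A : V → W` and `B : W → V`. Over that field, the linear
bijections are exactly the additive ones. -/
def AffineEquivalent {V W : Type*} [AddCommGroup V] [AddCommGroup W]
    (F : V → V) (G : W → W) : Prop :=
  ∃ (A : V ≃+ W) (B : W ≃+ V) (a : W) (b : V), ∀ x : V, F x = B (G (A x + a)) + b

section Coefficients

variable {K : Type*} [Field K]

def coeff1 (k : ℕ) (θ : K) : K :=
  1 + θ + θ ^ 2 + (θ + θ ^ 2) ^ (2 ^ k + 1) + θ ^ (2 * (2 ^ k + 1))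

def coeff2 (k : ℕ) (θ : K) : K :=
  (1 + θ + θ ^ 2) ^ 2 ^ k + (θ + θ ^ 2) ^ (2 ^ k + 1) + θ ^ (2 * (2 ^ k + 1))

def coeff3 (k : ℕ) (θ : K) : K :=
  1 + (θ + θ ^ 2) ^ (2 ^ k + 1)

def coeff4 (k : ℕ) (θ : K) : K :=
  (1 + θ + θ ^ 2) ^ (2 ^ k + 1) + (θ + θ ^ 2) ^ (2 ^ k + 1) + θ ^ (2 * (2 ^ k + 1))

/-- The bivariate polynomial `R(x, y) = (x + α y)^(2^k + 1) + (β y)^(2^k + 1)`. -/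
def butterflyR (k : ℕ) (α β x y : K) : K :=
  (x + α * y) ^ (2 ^ k + 1) + (β * y) ^ (2 ^ k + 1)

/-- The closed butterfly `V_R (x, y) = (R(x, y), R(y, x))`. -/
def closedButterfly (k : ℕ) (α β : K) (p : K × K) : K × K :=
  (butterflyR k α β p.1 p.2, butterflyR k α β p.2 p.1)

/-- The quadrinomial
`c₁ x^(2^k+1) + c₂ x̄^(2^k+1) + c₃ x^(2^k) x̄ + c₄ x x̄^(2^k)` with `x̄ = x^(2^m)`,
on an extension `L` of the field `K` containing `θ`. -/
def quadrinomial {L : Type*} [Field L] [Algebra K L] (m k : ℕ) (θ : K) (x : L) : L :=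
  algebraMap K L (coeff1 k θ) * x ^ (2 ^ k + 1)
    + algebraMap K L (coeff2 k θ) * (x ^ 2 ^ m) ^ (2 ^ k + 1)
    + algebraMap K L (coeff3 k θ) * (x ^ 2 ^ k * x ^ 2 ^ m)
    + algebraMap K L (coeff4 k θ) * (x * (x ^ 2 ^ m) ^ 2 ^ k)

end Coefficients

/-! ### Invariance under additive equivalence. -/

section Equivalence

variable {V : Type*} [AddCommGroup V]

/-! The quadrinomial is a Gold function in disguise: `F = B ∘ G ∘ A` with `G x = x σ(x)`, where `σ`
is the `(m + k)`-th power of Frobenius and `A`, `B` are additive bijections of the form `x ↦ s x + t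
x̄` (`quadrinomial_eq_gold`). Both uniformities are invariant under such a change, so only `G`
matters.

Since `m + k` is even and prime to `m`, the gcd of `m + k` and `2m` is `2`, and `σ` fixes exactly
the four elements of 𝔽₄. The polarization of `G` at `a` has kernel `a·𝔽₄`, which gives differential
uniformity 4. The boomerang bound needs one more fact, that `s + σ s` is never `1`
(`bct_goldMap_le`, `add_iterateFrobenius_ne_one`).

The butterfly form is independent of this: it is `F` written in the coordinates `ω u + ω² v`
(`quadrinomial_omega`). -/

theorem ddt_addEquiv_comp (A B : V ≃+ V) (F G : V → V) (h : ∀ x, F x = B (G (A x))) (a b : V) :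
    ddt F a b = ddt G (A a) (B.symm b) := by
  refine Nat.card_congr (A.toEquiv.subtypeEquiv fun x => ?_)
  simp [h, AddEquiv.eq_symm_apply]

theorem differentialUniformity_addEquiv_comp (A B : V ≃+ V) (F G : V → V)
    (h : ∀ x, F x = B (G (A x))) : differentialUniformity F = differentialUniformity G := by
  unfold differentialUniformity
  congr 1
  ext d
  constructor
  · rintro ⟨a, b, ha, rfl⟩
    exact ⟨A a, B.symm b, by simpa using ha, ddt_addEquiv_comp A B F G h a b⟩
  · rintro ⟨a, b, ha, rfl⟩
    exact ⟨A.symm a, B b, by simpa using ha, by simp [ddt_addEquiv_comp A B F G h]⟩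

theorem bct_addEquiv_comp (A B : V ≃+ V) (F G : Equiv.Perm V) (h : ∀ x, F x = B (G (A x)))
    (a b : V) : bct F a b = bct G (A a) (B.symm b) := by
  have hs : ∀ y, F.symm y = A.symm (G.symm (B.symm y)) := fun y => by
    rw [Equiv.symm_apply_eq, h]; simp
  refine Nat.card_congr (A.toEquiv.subtypeEquiv fun x => ?_)
  simp only [hs, h, map_add, AddEquiv.symm_apply_apply, AddEquiv.toEquiv_eq_coe,
    AddEquiv.coe_toEquiv]
  rw [← map_add, AddEquiv.symm_apply_eq]

theorem boomerangUniformity_addEquiv_comp (A B : V ≃+ V) (F G : Equiv.Perm V)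
    (h : ∀ x, F x = B (G (A x))) : boomerangUniformity F = boomerangUniformity G := by
  unfold boomerangUniformity
  congr 1
  ext d
  constructor
  · rintro ⟨a, b, ha, hb, rfl⟩
    exact ⟨A a, B.symm b, by simpa using ha, by simpa using hb, bct_addEquiv_comp A B F G h a b⟩
  · rintro ⟨a, b, ha, hb, rfl⟩
    exact ⟨A.symm a, B b, by simpa using ha, by simpa using hb,
      by simp [bct_addEquiv_comp A B F G h]⟩

end Equivalence

/-! ### Generalized Gold functions. -/

section Gold

variable {L : Type*} [Field L] [Finite L] [CharP L 2] (σ : L →+* L)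

/-- The generalized Gold function `x ↦ x σ(x)` attached to a field endomorphism `σ`. -/
def goldMap (x : L) : L := x * σ x

omit [Finite L] in
theorem goldMap_add_goldMap (x a : L) :
    goldMap σ x + goldMap σ (x + a) = x * σ a + a * σ x + goldMap σ a := by
  have h2 : (2 : L) = 0 := CharTwo.two_eq_zero
  simp only [goldMap, map_add]
  linear_combination (x * σ x) * h2

omit [Finite L] in
/-- The kernel of the polarization of `goldMap σ` at `a` is `a` times the fixed field of `σ`. -/
theorem gold_polar_eq_zero_iff {a : L} (ha : a ≠ 0) (x : L) :
    x * σ a + a * σ x = 0 ↔ σ (x / a) = x / a := by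
  have hσ : σ a ≠ 0 := by simpa using ha
  rw [map_div₀, div_eq_div_iff hσ ha, CharTwo.add_eq_zero]
  constructor <;> intro h <;> linear_combination -h

-- `goldMap σ` is multiplicative, so injectivity reduces to the fibre over `1`.
omit [CharP L 2] in
theorem goldMap_bijective (h1 : ∀ z, z * σ z = 1 → z = 1) : Function.Bijective (goldMap σ) := by
  rw [← Finite.injective_iff_bijective]
  intro x y hxy
  by_cases hy : y = 0
  · subst hy
    simpa [goldMap] using hxy
  · have hσ : σ y ≠ 0 := by simpa using hy
    have := h1 (x / y) (by
      rw [map_div₀, div_mul_div_comm, div_eq_one_iff_eq (mul_ne_zero hy hσ)]; exact hxy)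
    exact (div_eq_one_iff_eq hy).1 this

omit [CharP L 2] in
theorem card_le_of_sub_div_fixed {S : Set L} {a : L} (ha : a ≠ 0)
    (hS : ∀ x ∈ S, ∀ y ∈ S, σ ((x + y) / a) = (x + y) / a) :
    Nat.card S ≤ Nat.card {t : L // σ t = t} := by
  rcases S.eq_empty_or_nonempty with rfl | ⟨y, hy⟩
  · simp
  · refine Nat.card_le_card_of_injective
      (fun x : S => (⟨(x + y) / a, hS x x.2 y hy⟩ : {t : L // σ t = t})) fun x x' h => ?_
    have h' : ((x : L) + y) / a = (x' + y) / a := congrArg Subtype.val h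
    rw [div_left_inj' ha] at h'
    exact Subtype.ext (add_right_cancel h')

theorem ddt_goldMap_le {a : L} (ha : a ≠ 0) (b : L) :
    ddt (goldMap σ) a b ≤ Nat.card {t : L // σ t = t} := by
  refine card_le_of_sub_div_fixed σ (S := {x | goldMap σ x + goldMap σ (x + a) = b}) ha
    fun x hx y hy => ?_
  rw [← gold_polar_eq_zero_iff σ ha, map_add]
  rw [Set.mem_ofPred_eq, goldMap_add_goldMap] at hx hy
  have h2 : (2 : L) = 0 := CharTwo.two_eq_zero
  linear_combination hx + hy + (b - goldMap σ a) * h2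

omit [Finite L] in
theorem ddt_goldMap_one_one : ddt (goldMap σ) 1 1 = Nat.card {t : L // σ t = t} := by
  refine Nat.card_congr (Equiv.subtypeEquivRight fun x => ?_)
  rw [goldMap_add_goldMap]
  simp only [goldMap, map_one, mul_one, one_mul, add_eq_right]
  rw [CharTwo.add_eq_zero, eq_comm]

theorem differentialUniformity_goldMap :
    differentialUniformity (goldMap σ) = Nat.card {t : L // σ t = t} := by
  refine IsGreatest.csSup_eq ⟨⟨1, 1, one_ne_zero, (ddt_goldMap_one_one σ).symm⟩, ?_⟩
  rintro d ⟨a, b, ha, rfl⟩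
  exact ddt_goldMap_le σ ha b

omit [Finite L] in
/-- A solution `x` of the boomerang equation of a Gold permutation solves one of the
differential equations in a direction `a t` with `t` fixed by `σ`. -/
theorem exists_fixed_of_boomerang (hG : Function.Bijective (goldMap σ)) {a b : L} (ha : a ≠ 0)
    (hb : b ≠ 0) {x : L}
    (hx : (Equiv.ofBijective _ hG).symm (Equiv.ofBijective _ hG x + b)
      + (Equiv.ofBijective _ hG).symm (Equiv.ofBijective _ hG (x + a) + b) = a) :
    ∃ t, t ≠ 0 ∧ σ t = t ∧ b = t * (x * σ a + a * σ x) + t ^ 2 * goldMap σ a := by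
  have h2 : (2 : L) = 0 := CharTwo.two_eq_zero
  set y := (Equiv.ofBijective _ hG).symm (Equiv.ofBijective _ hG x + b) with hy
  have hy1 : goldMap σ y = goldMap σ x + b := by
    have := Equiv.apply_symm_apply (Equiv.ofBijective _ hG) (Equiv.ofBijective _ hG x + b)
    rwa [← hy] at this
  have hy2 : goldMap σ (y + a) = goldMap σ (x + a) + b := by
    have h : (Equiv.ofBijective _ hG).symm (Equiv.ofBijective _ hG (x + a) + b) = y + a := by
      linear_combination hx - y * h2
    rw [Equiv.symm_apply_eq] at h
    exact h.symm
  have hx3 := goldMap_add_goldMap σ x a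
  have hy3 := goldMap_add_goldMap σ y a
  have hz : (x + y) * σ a + a * σ (x + y) = 0 := by
    rw [map_add]
    linear_combination hy1 + hy2 - hx3 - hy3 +
      (goldMap σ x + goldMap σ (x + a) + b - goldMap σ a) * h2
  rw [gold_polar_eq_zero_iff σ ha] at hz
  set t := (x + y) / a with ht
  have hxy : y = x + a * t := by
    rw [ht]; field_simp; linear_combination (-x) * h2
  have hbt : b = t * (x * σ a + a * σ x) + t ^ 2 * goldMap σ a := by
    have h4 := goldMap_add_goldMap σ x (a * t)
    rw [← hxy, hy1, map_mul, hz] at h4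
    simp only [goldMap, map_mul, hz] at h4 ⊢
    linear_combination h4 - (x * σ x) * h2
  refine ⟨t, ?_, hz, hbt⟩
  rintro h0
  rw [h0] at hbt
  exact hb (by simpa using hbt)

/-- All solutions share the same fixed element `t` of `exists_fixed_of_boomerang`; they then solve a
single differential equation, so they differ by `a` times fixed elements. -/
theorem bct_goldMap_le (hG : Function.Bijective (goldMap σ)) (hσ : ∀ s, s + σ s ≠ 1) {a b : L}
    (ha : a ≠ 0) (hb : b ≠ 0) :
    bct (Equiv.ofBijective _ hG) a b ≤ Nat.card {t : L // σ t = t} := by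
  have h2 : (2 : L) = 0 := CharTwo.two_eq_zero
  refine card_le_of_sub_div_fixed σ
    (S := {x | (Equiv.ofBijective _ hG).symm (Equiv.ofBijective _ hG x + b)
      + (Equiv.ofBijective _ hG).symm (Equiv.ofBijective _ hG (x + a) + b) = a}) ha
    fun x hx y hy => ?_
  obtain ⟨t, ht0, htσ, ht⟩ := exists_fixed_of_boomerang σ hG ha hb hx
  obtain ⟨s, hs0, hsσ, hs⟩ := exists_fixed_of_boomerang σ hG ha hb hy
  have hσa : σ a ≠ 0 := by simpa using ha
  have hkey : s = t := by
    by_contra hst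
    have hst' : s + t ≠ 0 := fun h => hst (CharTwo.add_eq_zero.1 h)
    -- With `X = x/a`, `Y = y/a`, equating both formulas for `b / (a σ a)` gives `w + σ w = (s +
    -- t)²` for `w = tX + sY`; the right side is fixed by `σ`, so dividing by it yields the
    -- forbidden value `1`.
    refine hσ ((t * x + s * y) / (a * (s + t) ^ 2)) ?_
    simp only [map_div₀, map_add, map_mul, map_pow, htσ, hsσ]
    field_simp
    simp only [goldMap] at ht hs
    linear_combination hs - ht + (s * (y * σ a + a * σ y) - s * t * a * σ a - t ^ 2 * (a * σ a)) * h2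
  subst hkey
  rw [← gold_polar_eq_zero_iff σ ha, map_add]
  refine mul_left_cancel₀ hs0 ?_
  linear_combination - hs - ht + (b - s ^ 2 * goldMap σ a) * h2

/-- On the fixed field `goldMap σ` is squaring, which is additive, so every fixed element is a
solution. -/
theorem le_bct_goldMap_one_one (hG : Function.Bijective (goldMap σ)) :
    Nat.card {t : L // σ t = t} ≤ bct (Equiv.ofBijective _ hG) 1 1 := by
  have h2 : (2 : L) = 0 := CharTwo.two_eq_zero
  have key : ∀ x : L, σ x = x → (Equiv.ofBijective _ hG).symm (Equiv.ofBijective _ hG x + 1)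
      = x + 1 := fun x hx => by
    rw [Equiv.symm_apply_eq]
    simp only [Equiv.ofBijective_apply, goldMap, map_add, map_one, hx]
    linear_combination (-x) * h2
  refine Nat.card_le_card_of_injective (fun x : {t : L // σ t = t} =>
    (⟨x.1, ?_⟩ : {x : L // (Equiv.ofBijective _ hG).symm (Equiv.ofBijective _ hG x + 1)
      + (Equiv.ofBijective _ hG).symm (Equiv.ofBijective _ hG (x + 1) + 1) = 1})) ?_
  · rw [key _ x.2, key _ (by rw [map_add, x.2, map_one])]
    linear_combination (x.1 + 1) * h2
  · intro x y h
    rw [Subtype.mk.injEq] at h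
    exact Subtype.ext h

theorem boomerangUniformity_goldMap (hG : Function.Bijective (goldMap σ))
    (hσ : ∀ s, s + σ s ≠ 1) :
    boomerangUniformity (Equiv.ofBijective _ hG) = Nat.card {t : L // σ t = t} := by
  refine IsGreatest.csSup_eq ⟨⟨1, 1, one_ne_zero, one_ne_zero, ?_⟩, ?_⟩
  · exact (le_bct_goldMap_one_one σ hG).antisymm
      (bct_goldMap_le σ hG hσ one_ne_zero one_ne_zero)
  · rintro d ⟨a, b, ha, hb, rfl⟩
    exact bct_goldMap_le σ hG hσ ha hb

end Gold

/-! ### Arithmetic of powers of Frobenius. -/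

section FrobeniusPowers

variable {L : Type*} [Field L]

theorem pow_two_pow_gcd_eq_self {z : L} {i j : ℕ} (hi : z ^ 2 ^ i = z) (hj : z ^ 2 ^ j = z) :
    z ^ 2 ^ Nat.gcd i j = z := by
  have key : ∀ r, Function.IsPeriodicPt (fun x : L => x ^ 2) r z ↔ z ^ 2 ^ r = z := fun r => by
    rw [Function.IsPeriodicPt, Function.IsFixedPt, pow_iterate]
  exact (key _).1 (((key i).2 hi).gcd ((key j).2 hj))

variable [Finite L] [CharP L 2]

omit [CharP L 2] in
theorem exists_sq_add_self_add_one_eq_zero {m : ℕ} (hL : Nat.card L = 2 ^ (2 * m)) :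
    ∃ ω : L, ω ^ 2 + ω + 1 = 0 := by
  have h3 : 3 ∣ Nat.card Lˣ := by
    rw [Nat.card_units, hL, pow_mul]
    simpa using Nat.sub_dvd_pow_sub_pow 4 1 m
  have : Fact (Nat.Prime 3) := ⟨Nat.prime_three⟩
  obtain ⟨u, hu⟩ := exists_prime_orderOf_dvd_card' 3 h3
  have hu3 : (u : L) ^ 3 = 1 := by
    rw [← Units.val_pow_eq_pow_val, ← hu, pow_orderOf_eq_one, Units.val_one]
  have hu1 : (u : L) - 1 ≠ 0 := fun h => by
    rw [sub_eq_zero, Units.val_eq_one] at h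
    rw [h, orderOf_one] at hu
    omega
  exact ⟨u, mul_left_cancel₀ hu1 (by linear_combination hu3)⟩

omit [Finite L] [CharP L 2] in
theorem omega_pow_two_pow_odd {ω : L} (hω : ω ^ 2 + ω + 1 = 0) {i : ℕ} (hi : Odd i) :
    ω ^ 2 ^ i = ω ^ 2 := by
  have h4 : ω ^ 4 = ω := by linear_combination (ω ^ 2 - ω) * hω
  obtain ⟨j, rfl⟩ := hi
  have : ∀ j : ℕ, ω ^ 4 ^ j = ω := fun j => by
    induction j with
    | zero => simp
    | succ j ih => rw [pow_succ, pow_mul, ih, h4]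
  rw [pow_succ, pow_mul 2 2 j, pow_mul]
  norm_num [this]

omit [Finite L] in
theorem card_pow_four_eq_self {ω : L} (hω : ω ^ 2 + ω + 1 = 0) :
    Nat.card {t : L // t ^ 4 = t} = 4 := by
  classical
  have h2 : (2 : L) = 0 := CharTwo.two_eq_zero
  have h0 : ω ≠ 0 := by rintro rfl; simp at hω
  have h1 : ω ≠ 1 := by
    rintro rfl
    exact one_ne_zero (α := L) (by linear_combination hω - h2)
  have hset : {t : L | t ^ 4 = t} = (({0, 1, ω, ω + 1} : Finset L) : Set L) := by
    ext t
    have : t ^ 4 - t = t * (t - 1) * ((t - ω) * (t - (ω + 1))) := by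
      linear_combination (t ^ 2 - t) * hω + (t ^ 3 + t ^ 3 * ω - 2 * t ^ 2 * ω - t ^ 2 * ω ^ 2 - t ^ 2
        + t * ω ^ 2 + t * ω) * h2
    rw [Set.mem_ofPred_eq, ← sub_eq_zero, this]
    simp only [mul_eq_zero, sub_eq_zero, Finset.coe_insert, Finset.coe_singleton,
      Set.mem_insert_iff, Set.mem_singleton_iff]
    tauto
  change Nat.card ({t : L | t ^ 4 = t} : Set L) = 4
  rw [hset, Nat.card_coe_set_eq, Set.ncard_coe_finset]
  have h01 : ω + 1 ≠ 0 := fun h => h1 (CharTwo.add_eq_zero.1 h)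
  have hω1 : ω ≠ ω + 1 := by simp
  have h11 : (1 : L) ≠ ω + 1 := by simpa using h0
  rw [Finset.card_insert_of_notMem, Finset.card_insert_of_notMem, Finset.card_insert_of_notMem,
    Finset.card_singleton]
  · simp
  · simpa using ⟨h1.symm, h0⟩
  · simpa using ⟨h0.symm, h01.symm⟩

variable {m k : ℕ}

omit [CharP L 2] in
theorem pow_two_pow_natCard {n : ℕ} (hL : Nat.card L = 2 ^ n) (x : L) : x ^ 2 ^ n = x := by
  have := Fintype.ofFinite L
  rw [← hL, Nat.card_eq_fintype_card, FiniteField.pow_card]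

theorem iterateFrobenius_eq_self_iff (hL : Nat.card L = 2 ^ (2 * m))
    (hk : Odd k) (hm : Odd m) (hmk : Nat.Coprime (m + k) m) (t : L) :
    iterateFrobenius L 2 (m + k) t = t ↔ t ^ 4 = t := by
  rw [iterateFrobenius_def]
  obtain ⟨r, hr⟩ := (hm.add_odd hk).two_dvd
  constructor
  · intro h
    have := pow_two_pow_gcd_eq_self h (pow_two_pow_natCard hL t)
    have hg : Nat.gcd (m + k) (2 * m) = 2 := by
      rw [Nat.Coprime.gcd_mul_right_cancel_right 2 hmk.symm, hr]
      simp
    rw [hg] at this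
    simpa using this
  · intro h
    rw [hr, pow_mul]
    norm_num
    clear hr
    induction r with
    | zero => simp
    | succ r ih => rw [pow_succ, pow_mul, ih, h]

/-- Here `σ` inverts `z`, so `σ²` fixes it; since `gcd(2(m+k), 2m) = 2`, `z` lies in 𝔽₄, where `σ`
is trivial, and `z² = 1`. -/
theorem eq_one_of_mul_iterateFrobenius_eq_one (hL : Nat.card L = 2 ^ (2 * m))
    (hk : Odd k) (hm : Odd m) (hmk : Nat.Coprime (m + k) m) {z : L}
    (hz : z * iterateFrobenius L 2 (m + k) z = 1) : z = 1 := by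
  have hz0 : z ≠ 0 := by rintro rfl; simp at hz
  have hinv : iterateFrobenius L 2 (m + k) z = z⁻¹ := eq_inv_of_mul_eq_one_right hz
  have h2 : z ^ 2 ^ (2 * (m + k)) = z := by
    rw [two_mul, ← iterateFrobenius_def, iterateFrobenius_add_apply, hinv, map_inv₀, hinv, inv_inv]
  have h4 := pow_two_pow_gcd_eq_self h2 (pow_two_pow_natCard hL z)
  rw [Nat.gcd_mul_left, hmk] at h4
  rw [(iterateFrobenius_eq_self_iff hL hk hm hmk z).2 (by simpa using h4)] at hz
  exact CharTwo.sq_injective (by simpa [sq] using hz)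

/-- Otherwise `σ s = s + 1`, and `m` iterations give `s + m = s + 1`. But `m + k` is even, so `σ^m`
is a power of `x ↦ x^(2^(2m))`, the identity. -/
theorem add_iterateFrobenius_ne_one (hL : Nat.card L = 2 ^ (2 * m)) (hk : Odd k) (hm : Odd m)
    (s : L) : s + iterateFrobenius L 2 (m + k) s ≠ 1 := by
  intro h
  have h2 : (2 : L) = 0 := CharTwo.two_eq_zero
  have hs : iterateFrobenius L 2 (m + k) s = s + 1 := by linear_combination h - s * h2
  have hit : ∀ j : ℕ, (iterateFrobenius L 2 (m + k))^[j] s = s + j := fun j => by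
    induction j with
    | zero => simp
    | succ j ih =>
      rw [Function.iterate_succ_apply', ih, map_add, hs, map_natCast]
      push_cast
      ring
  obtain ⟨r, hr⟩ := (hm.add_odd hk).two_dvd
  have hfix : (iterateFrobenius L 2 (m + k))^[m] s = s := by
    rw [← iterateFrobenius_mul_apply, iterateFrobenius_def, hr, mul_right_comm, pow_mul]
    generalize r = r
    induction r with
    | zero => simp
    | succ r ih => rw [pow_succ, pow_mul, ih, pow_two_pow_natCard hL]
  have := hit m
  rw [hfix, CharTwo.natCast_eq_ite, if_neg (Nat.not_even_iff_odd.2 hm)] at this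
  simp at this

end FrobeniusPowers

/-! ### The quadrinomial as a Gold function and as a butterfly. -/

section Quadrinomial

variable {K L : Type*} [Field K] [Field L] [Algebra K L] [Finite L] [CharP L 2] {m k : ℕ}

/-- The additive bijection `x ↦ s x + t x̄` of `L`, for distinct `s`, `t` in the subfield `K`. -/
theorem exists_addEquiv_add_conj (hL : Nat.card L = 2 ^ (2 * m)) {s t : L}
    (hs : s ^ 2 ^ m = s) (ht : t ^ 2 ^ m = t) (hst : s ≠ t) :
    ∃ A : L ≃+ L, ∀ x, A x = s * x + t * x ^ 2 ^ m := by
  let f : L →+ L := (AddMonoidHom.mulLeft s) +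
    (AddMonoidHom.mulLeft t).comp (iterateFrobenius L 2 m : L →+* L).toAddMonoidHom
  have hf : ∀ x, f x = s * x + t * x ^ 2 ^ m := fun x => rfl
  have hinj : Function.Injective f := by
    rw [injective_iff_map_eq_zero]
    intro x hx
    rw [hf] at hx
    -- With its conjugate, the equation is a linear system in `x`, `x̄` of determinant `s² - t² = (s
    -- - t)²`.
    have hconj : s * x ^ 2 ^ m + t * x = 0 := by
      have h := congrArg (iterateFrobenius L 2 m) hx
      simp only [map_add, map_mul, map_zero, iterateFrobenius_def, hs, ht] at h
      rwa [← pow_mul, ← pow_add, ← two_mul, pow_two_pow_natCard hL] at h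
    have hst' : (s - t) ^ 2 * x = 0 := by
      have h2 : (2 : L) = 0 := CharTwo.two_eq_zero
      linear_combination s * hx - t * hconj + (t ^ 2 * x - s * t * x) * h2
    simpa [sub_eq_zero, hst] using hst'
  exact ⟨AddEquiv.ofBijective f (Finite.injective_iff_bijective.1 hinj), hf⟩

theorem quadrinomial_eq_gold (hm : Odd m) (hL : Nat.card L = 2 ^ (2 * m)) (hK : Nat.card K = 2 ^ m)
    {θ : K} (hθ : θ ≠ 0) :
    ∃ A B : L ≃+ L, ∀ x,
      quadrinomial m k θ x = B (goldMap (iterateFrobenius L 2 (m + k)) (A x)) := by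
  have : Finite K := Nat.finite_of_card_ne_zero (by rw [hK]; positivity)
  have hKL : ∀ c : K, algebraMap K L c ^ 2 ^ m = algebraMap K L c := fun c => by
    rw [← map_pow, pow_two_pow_natCard hK]
  have : CharP K 2 := (algebraMap K L).charP (algebraMap K L).injective 2
  set a := algebraMap K L θ with ha
  set b := algebraMap K L (θ ^ 2 ^ k) with hb
  have hba : a ^ 2 ^ k = b := by rw [ha, hb, map_pow]
  -- Needed for `B` to be bijective. The iteration argument is run in `K`, where `m` iterates of any
  -- Frobenius power are trivial.
  have hT : θ + θ ^ 2 ^ k ≠ 1 := by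
    intro h
    have hs : iterateFrobenius K 2 k θ = θ + 1 := by
      rw [iterateFrobenius_def]
      have h2 : (2 : K) = 0 := CharTwo.two_eq_zero
      linear_combination h - θ * h2
    have hit : ∀ j : ℕ, (iterateFrobenius K 2 k)^[j] θ = θ + j := fun j => by
      induction j with
      | zero => simp
      | succ j ih =>
        rw [Function.iterate_succ_apply', ih, map_add, hs, map_natCast]
        push_cast
        ring
    have hfix : (iterateFrobenius K 2 k)^[m] θ = θ := by
      rw [← iterateFrobenius_mul_apply, iterateFrobenius_def, mul_comm, pow_mul]
      generalize k = r
      induction r with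
      | zero => simp
      | succ r ih => rw [pow_succ, pow_mul, ih, pow_two_pow_natCard hK]
    have := hit m
    rw [hfix, CharTwo.natCast_eq_ite, if_neg (Nat.not_even_iff_odd.2 hm)] at this
    simp at this
  have hT' : a + b ≠ 1 := by
    rw [ha, hb, ← map_add, ← map_one (algebraMap K L)]
    exact (algebraMap K L).injective.ne hT
  have haL : a ≠ 0 := by simpa [ha] using hθ
  have ham : a ^ 2 ^ m = a := hKL _
  have hbm : b ^ 2 ^ m = b := hKL _
  obtain ⟨A, hA⟩ := exists_addEquiv_add_conj hL (s := 1 + a) (t := 1)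
    (by rw [add_pow_char_pow, ham, one_pow]) (one_pow _) (by simpa using haL)
  obtain ⟨B, hB⟩ := exists_addEquiv_add_conj hL (s := a + b + a * b) (t := 1 + a * b)
    (by rw [add_pow_char_pow, add_pow_char_pow, mul_pow, ham, hbm])
    (by rw [add_pow_char_pow, mul_pow, ham, hbm, one_pow])
    (by simpa using hT')
  refine ⟨A, B, fun x => ?_⟩
  have hy : (x ^ 2 ^ m) ^ 2 ^ m = x := by
    rw [← pow_mul, ← pow_add, ← two_mul, pow_two_pow_natCard hL]
  rw [hB, hA, goldMap, iterateFrobenius_add_apply]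
  simp only [iterateFrobenius_def, quadrinomial, coeff1, coeff2, coeff3, coeff4,
    mul_pow, one_pow, add_pow_char_pow, ham, map_add, map_mul, map_pow, map_one,
    pow_succ _ (2 ^ k), mul_comm 2 (2 ^ k + 1), pow_mul _ (2 ^ k + 1) 2, ← ha, hba, hy, hbm,
    pow_right_comm (x ^ 2 ^ m) (2 ^ k) (2 ^ m), pow_right_comm a 2 (2 ^ k),
    pow_right_comm x (2 ^ k) (2 ^ m)]
  generalize (x ^ 2 ^ m) ^ 2 ^ k = r
  generalize x ^ 2 ^ k = p
  generalize x ^ 2 ^ m = y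
  grind

/-- For odd `m`, `K` has no primitive cube root of unity: `x ↦ x^(2^m)` would square it, yet it is
the identity on `K`. -/
theorem sq_add_self_add_one_ne_zero (hm : Odd m) (hK : Nat.card K = 2 ^ m) [CharP K 2] (θ : K) :
    1 + θ + θ ^ 2 ≠ 0 := by
  intro h
  have : Finite K := Nat.finite_of_card_ne_zero (by rw [hK]; positivity)
  have h' : θ ^ 2 + θ + 1 = 0 := by linear_combination h
  have h1 := omega_pow_two_pow_odd h' hm
  rw [pow_two_pow_natCard hK] at h1
  have : (1 : K) = 0 := by
    have h2 : (2 : K) = 0 := CharTwo.two_eq_zero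
    linear_combination h' + h1 - θ * h2
  exact one_ne_zero this

/-- The coordinates `(u, v) ↦ c (ω u + ω² v)` on `L` for a primitive cube root of unity `ω`. -/
theorem exists_addEquiv_omega (hm : Odd m) (hL : Nat.card L = 2 ^ (2 * m))
    (hK : Nat.card K = 2 ^ m) {ω : L} (hω : ω ^ 2 + ω + 1 = 0) {c : L} (hc : c ≠ 0) :
    ∃ E : K × K ≃+ L, ∀ p, E p = c * (ω * algebraMap K L p.1 + ω ^ 2 * algebraMap K L p.2) := by
  have : Finite K := Nat.finite_of_card_ne_zero (by rw [hK]; positivity)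
  have hKL : ∀ c : K, algebraMap K L c ^ 2 ^ m = algebraMap K L c := fun c => by
    rw [← map_pow, pow_two_pow_natCard hK]
  let f : K × K →+ L := AddMonoidHom.mk'
    (fun p => c * (ω * algebraMap K L p.1 + ω ^ 2 * algebraMap K L p.2))
    fun p q => by simp only [Prod.fst_add, Prod.snd_add, map_add]; ring
  have hf : ∀ p, f p = c * (ω * algebraMap K L p.1 + ω ^ 2 * algebraMap K L p.2) := fun p => rfl
  have hinj : Function.Injective f := by
    rw [injective_iff_map_eq_zero]
    rintro ⟨u, v⟩ h
    rw [hf, mul_eq_zero, or_iff_right hc] at h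
    have hconj := congrArg (iterateFrobenius L 2 m) h
    simp only [map_add, map_mul, map_pow, map_zero, iterateFrobenius_def, hKL,
      omega_pow_two_pow_odd hω hm] at hconj
    simp only at h
    set U := algebraMap K L u with hU
    set V := algebraMap K L v with hV
    have huv : U = V := by grind
    have hu0 : U = 0 := by grind
    have hv0 : V = 0 := huv ▸ hu0
    rw [Prod.mk_eq_zero]
    exact ⟨by simpa [hU] using hu0, by simpa [hV] using hv0⟩
  have hcard : Nat.card (K × K) = Nat.card L := by
    rw [Nat.card_prod, hK, hL, two_mul, pow_add]
  exact ⟨AddEquiv.ofBijective f ((Nat.bijective_iff_injective_and_card f).2 ⟨hinj, hcard⟩), hf⟩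

theorem pow_mul_butterflyR [CharP K 2] {θ : K} (hD : 1 + θ + θ ^ 2 ≠ 0) (x y : K) :
    (1 + θ + θ ^ 2) ^ (2 ^ k + 1) *
        butterflyR k (1 / (1 + θ + θ ^ 2)) (θ ^ 2 / (1 + θ + θ ^ 2)) x y
      = ((1 + θ ^ 2 ^ k + (θ ^ 2 ^ k) ^ 2) * x ^ 2 ^ k + y ^ 2 ^ k)
          * ((1 + θ + θ ^ 2) * x + y) + (θ ^ 2 ^ k) ^ 2 * y ^ 2 ^ k * (θ ^ 2 * y) := by
  have h1 : (1 + θ + θ ^ 2) * (x + 1 / (1 + θ + θ ^ 2) * y) = (1 + θ + θ ^ 2) * x + y := by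
    field_simp
  have h2 : (1 + θ + θ ^ 2) * (θ ^ 2 / (1 + θ + θ ^ 2) * y) = θ ^ 2 * y := by
    field_simp
  rw [butterflyR, mul_add, ← mul_pow, ← mul_pow, h1, h2]
  simp only [pow_succ _ (2 ^ k), add_pow_char_pow, mul_pow, one_pow, pow_right_comm θ 2 (2 ^ k)]

-- As `m` and `k` are odd, both Frobenius powers swap `ω` and `ω²`; after clearing the denominators
-- of `R`, the claim is a polynomial identity modulo `ω² + ω + 1`.
omit [Finite L] in
theorem quadrinomial_omega (hm : Odd m) (hk : Odd k) (hK : Nat.card K = 2 ^ m) {ω : L}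
    (hω : ω ^ 2 + ω + 1 = 0) (θ u v : K) :
    quadrinomial m k θ (ω * algebraMap K L u + ω ^ 2 * algebraMap K L v) =
      algebraMap K L ((1 + θ + θ ^ 2) ^ (2 ^ k + 1)) *
      (ω * algebraMap K L (butterflyR k (1 / (1 + θ + θ ^ 2)) (θ ^ 2 / (1 + θ + θ ^ 2)) u v)
      + ω ^ 2 * algebraMap K L
          (butterflyR k (1 / (1 + θ + θ ^ 2)) (θ ^ 2 / (1 + θ + θ ^ 2)) v u)) := by
  have : Finite K := Nat.finite_of_card_ne_zero (by rw [hK]; positivity)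
  have : CharP K 2 := (algebraMap K L).charP (algebraMap K L).injective 2
  have hD := sq_add_self_add_one_ne_zero hm hK θ
  have hKL : ∀ c : K, algebraMap K L c ^ 2 ^ m = algebraMap K L c := fun c => by
    rw [← map_pow, pow_two_pow_natCard hK]
  have hωm := omega_pow_two_pow_odd hω hm
  have hωk := omega_pow_two_pow_odd hω hk
  have hω4 : (ω ^ 2) ^ 2 = ω := by linear_combination (ω ^ 2 - ω) * hω
  rw [mul_add, mul_left_comm, mul_left_comm _ (ω ^ 2), ← map_mul, ← map_mul,
    pow_mul_butterflyR hD, pow_mul_butterflyR hD]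
  simp only [quadrinomial, coeff1, coeff2, coeff3, coeff4,
    mul_pow, one_pow, add_pow_char_pow, map_add, map_mul, map_pow, map_one,
    pow_succ _ (2 ^ k), mul_comm 2 (2 ^ k + 1), pow_mul _ (2 ^ k + 1) 2, hKL,
    pow_right_comm ω 2 (2 ^ k), pow_right_comm ω 2 (2 ^ m), hωm, hωk, hω4,
    pow_right_comm _ 2 (2 ^ k)]
  generalize algebraMap K L θ ^ 2 ^ k = b
  generalize algebraMap K L θ = a
  generalize algebraMap K L u ^ 2 ^ k = p
  generalize algebraMap K L v ^ 2 ^ k = r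
  generalize algebraMap K L u = x
  generalize algebraMap K L v = y
  grind

end Quadrinomial

theorem theorem2 {K L : Type*} [Field K] [Field L] [Algebra K L]
    (m n k : ℕ) (hn : n = 2 * m) (hm : Odd m) (hk : Nat.gcd n k = 1)
    (hK : Nat.card K = 2 ^ m) (hL : Nat.card L = 2 ^ n)
    (θ : K) (hθ : θ ≠ 0) :
    (∃ hF : Function.Bijective (quadrinomial m k θ : L → L),
      boomerangUniformity (Equiv.ofBijective (quadrinomial m k θ : L → L) hF) = 4) ∧
    differentialUniformity (quadrinomial m k θ : L → L) = 4 ∧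
    AffineEquivalent (quadrinomial m k θ : L → L)
      (closedButterfly k (1 / (1 + θ + θ ^ 2)) (θ ^ 2 / (1 + θ + θ ^ 2))) := by
  subst hn
  have hLfin : Finite L := Nat.finite_of_card_ne_zero (by rw [hL]; positivity)
  have hchar : CharP L 2 := by
    have := Fintype.ofFinite L
    exact charP_of_card_eq_prime_pow (f := 2 * m) (by rw [← Nat.card_eq_fintype_card, hL])
  have hkodd : Odd k := (Nat.Coprime.coprime_mul_right hk).odd_of_left
  have hmk : Nat.Coprime (m + k) m := by
    rw [Nat.coprime_self_add_left]
    exact (Nat.Coprime.coprime_mul_left hk).symm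
  obtain ⟨ω, hω⟩ := exists_sq_add_self_add_one_eq_zero hL
  have hG := goldMap_bijective (iterateFrobenius L 2 (m + k))
    fun z => eq_one_of_mul_iterateFrobenius_eq_one hL hkodd hm hmk
  have hcard : Nat.card {t : L // iterateFrobenius L 2 (m + k) t = t} = 4 := by
    rw [← card_pow_four_eq_self hω]
    exact Nat.card_congr
      (Equiv.subtypeEquivRight (iterateFrobenius_eq_self_iff hL hkodd hm hmk))
  obtain ⟨A, B, hAB⟩ := quadrinomial_eq_gold (k := k) hm hL hK hθ
  have hF : Function.Bijective (quadrinomial m k θ : L → L) := by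
    rw [funext hAB]
    exact B.bijective.comp (hG.comp A.bijective)
  refine ⟨⟨hF, ?_⟩, ?_, ?_⟩
  · rw [boomerangUniformity_addEquiv_comp A B _ (Equiv.ofBijective _ hG) hAB,
      boomerangUniformity_goldMap _ hG (add_iterateFrobenius_ne_one hL hkodd hm), hcard]
  · rw [differentialUniformity_addEquiv_comp A B _ _ hAB, differentialUniformity_goldMap, hcard]
  · have : CharP K 2 := (algebraMap K L).charP (algebraMap K L).injective 2
    have hD := sq_add_self_add_one_ne_zero hm hK θ
    obtain ⟨E, hE⟩ := exists_addEquiv_omega hm hL hK hω one_ne_zero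
    obtain ⟨E', hE'⟩ := exists_addEquiv_omega hm hL hK hω
      (c := algebraMap K L ((1 + θ + θ ^ 2) ^ (2 ^ k + 1))) ((map_ne_zero _).2 (pow_ne_zero _ hD))
    refine ⟨E.symm, E', 0, 0, fun x => ?_⟩
    obtain ⟨⟨u, v⟩, rfl⟩ := E.surjective x
    rw [AddEquiv.symm_apply_apply, add_zero, add_zero, hE, hE', one_mul]
    exact quadrinomial_omega hm hkodd hK hω θ u v
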